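/- \textbf{Definitions.} A polytope $P\subset\mathbb R^d$ is the convex hull of a finite set; $\operatorname{Lin}P$ is the span of the differences of its points and $\dim P=\dim\operatorname{Lin}P$. Its faces are the empty set and the sets $P^{\phi}=\{x\in P:\phi(x)=\max_P\phi\}$, $\phi\in(\mathbb R^d)^*$; a facet of $P$ is a face of dimension $\dim P-1$. A \emph{frame} is an ordered basis $(v_1,\dots,v_d)$ of $\mathbb R^d$. Put $V_k=\operatorname{span}(v_1,\dots,v_k)$, and let $\pi_k:\mathbb R^d\to V_k$ be the linear map that fixes $v_1,\dots,v_k$ and kills $v_{k+1},\dots,v_d$. The frame is \emph{$P$-admissible}, and $P$ is then \emph{framed} by it, if for every $k$ and every $k$-dimensional face $F$ of $P$ the restriction $\pi_k:\operatorname{Lin}F\to V_k$ is an isomorphism; write $\sigma^F_k$ for its inverse. Every face $F$ of dimension $k$ is then oriented by $\beta_F=\sigma_k^F(v_1)\wedge\dots\wedge\sigma_k^F(v_k)$ (by $1$ if $k=0$). The \emph{source} (resp. \emph{target}) of a framed polytope $P$ is the set of facets $F$ of $P$ for which there are $v\in\operatorname{Lin}P$ and a functional $n$ with $F=P^{n}$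 such that $\langle n,v\rangle<0$ (resp. $>0$) and $\beta_P=c\,\beta_F\wedge v$ for some $c>0$. For $k<\dim P$, the \emph{$k$-source} (resp. \emph{$k$-target}) of $P$ is the set of $k$-dimensional faces $F$ of $P$ such that $\pi_{k+1}(F)$ is a facet of $\pi_{k+1}(P)$ that belongs to the source (resp. target) of $\pi_{k+1}(P)$, the latter being framed by $(v_1,\dots,v_{k+1})$ in $V_{k+1}$. The faces of a framed polytope are framed by the same frame. A \emph{cellular $k$-string} of a framed polytope $P$ is a finite sequence $F_1,\dots,F_m$ of faces of $P$ of dimension greater than $k$ such that, for every $1\le i<m$, some face lies both in the $k$-target of $F_i$ and in the $k$-source of $F_{i+1}$. A \emph{cellular $k$-loop} is a cellular $k$-string with $F_i=F_j$ for some $i\neq j$. \textbf{Theorem.} For every $d$, let $x_1,\dots,x_{d+1}$ be independent random points of $\mathbb R^d$, each with the standard normal distribution on $\mathbb R^d$, and let $X_d=\operatorname{conv}(x_1,\dots,x_{d+1})$ (a \emph{Gaussian $d$-simplex}). Then for every $k\ge 1$ the probability that $X_d$ is framed by the canonical frame $(e_1,\dots,e_d)$ and has a cellular $k$-loop with respect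 to it tends to $1$ as $d\to\infty$. -/

import Mathlib

open MeasureTheory ProbabilityTheory Filter Topology

noncomputable section

namespace FramedPolytope

/-- The Euclidean space `ℝ^d`. -/
abbrev E (d : ℕ) : Type := EuclideanSpace ℝ (Fin d)

variable {d : ℕ}

/-! ### Polytopes and their faces

The faces of `P` (the empty one included) are the sets `F` with `IsExposed ℝ P F`: they are the
maximal loci of linear functionals on `P`, and the empty set. -/

/-- A polytope is the convex hull of a finite set of points. -/
def IsPolytope (P : Set (E d)) : Prop :=
  ∃ S : Finset (E d), P = convexHull ℝ (S : Set (E d))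

/-- `Lin P`, the linear span of the differences of points of `P`. -/
def Lin (P : Set (E d)) : Submodule ℝ (E d) := vectorSpan ℝ P

/-- The dimension of a nonempty polytope (for the empty set this is the junk value `0`; wherever
dimensions matter below, the set is nonempty). -/
def dim (P : Set (E d)) : ℕ := Module.finrank ℝ (Lin P)

/-- The set of `k`-faces of `P`. -/
def faces (k : ℕ) (P : Set (E d)) : Set (Set (E d)) :=
  {F | IsExposed ℝ P F ∧ F.Nonempty ∧ dim F = k}

/-- The facets of `P`: its faces of codimension one. -/
def facets (P : Set (E d)) : Set (Set (E d)) :=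
  {F | IsExposed ℝ P F ∧ F.Nonempty ∧ dim F + 1 = dim P}

/-- The normal cone of the face `F` of `P`: the functionals whose maximal locus on `P` is `F`. -/
def normalCone (P F : Set (E d)) : Set (StrongDual ℝ (E d)) :=
  {n | F = {x ∈ P | ∀ y ∈ P, n y ≤ n x}}

/-! ### Frames -/

/-- A frame is an ordered basis of `ℝ^d`. -/
abbrev Frame (d : ℕ) : Type := Module.Basis (Fin d) ℝ (E d)

/-- The canonical frame `(e₁, …, e_d)`. -/
def canonicalFrame (d : ℕ) : Frame d := (EuclideanSpace.basisFun (Fin d) ℝ).toBasis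

/-- The frame vectors, indexed from zero: `vec B i` is the vector usually written `v_{i+1}`
(and `0` when there is none). -/
def vec (B : Frame d) (i : ℕ) : E d := if h : i < d then B ⟨i, h⟩ else 0

/-- `V_k`, the span of the first `k` frame vectors. -/
def V (B : Frame d) (k : ℕ) : Submodule ℝ (E d) :=
  Submodule.span ℝ {x | ∃ i : Fin d, (i : ℕ) < k ∧ x = B i}

/-- The projection `π_k` onto `V_k`, which fixes the first `k` frame vectors and kills the
others. -/
def proj (B : Frame d) (k : ℕ) : E d →ₗ[ℝ] E d :=
  B.constr ℝ fun i : Fin d => if (i : ℕ) < k then B i else 0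

/-- `B` is `P`-admissible: for every `k`-face `F` of `P`, the (linear) map `π_k` restricts to a
bijection from `Lin F` onto `V_k`. -/
def IsAdmissible (B : Frame d) (P : Set (E d)) : Prop :=
  ∀ k : ℕ, ∀ F ∈ faces k P, Set.BijOn (proj B k) (Lin F : Set (E d)) (V B k : Set (E d))

/-- `P` is a polytope framed by `B`. -/
def IsFramed (B : Frame d) (P : Set (E d)) : Prop :=
  IsPolytope P ∧ IsAdmissible B P

/-- The inverse `σ_k^F : V_k → Lin F` of the bijection `π_k : Lin F → V_k`. -/
def inverseProj (B : Frame d) (k : ℕ) (F : Set (E d)) : E d → E d :=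
  Function.invFunOn (proj B k) (Lin F : Set (E d))

/-! ### Orientations, sources and targets

Orientations of `Lin F` are represented in the exterior algebra of `ℝ^d`, into which the exterior
algebra of `Lin F` embeds. -/

/-- Equivalence of generators: `β = c • β'` for some `c > 0`. -/
def OrientEquiv (β β' : ExteriorAlgebra ℝ (E d)) : Prop :=
  ∃ c : ℝ, 0 < c ∧ β = c • β'

/-- The induced orientation `σ_k^F(v₁) ∧ … ∧ σ_k^F(v_k)` on a `k`-dimensional `F`
(it is `1` when `k = 0`). -/
def orientation (B : Frame d) (F : Set (E d)) : ExteriorAlgebra ℝ (E d) :=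
  ExteriorAlgebra.ιMulti ℝ (dim F) fun i : Fin (dim F) => inverseProj B (dim F) F (vec B i)

/-- The source of `P` with respect to the induced orientations: the facets whose orientation is
completed to that of `P` by wedging, on the right, with an inner-pointing vector. -/
def source (B : Frame d) (P : Set (E d)) : Set (Set (E d)) :=
  {F | F ∈ facets P ∧ ∃ v ∈ Lin P, ∃ n ∈ normalCone P F, n v < 0 ∧
    OrientEquiv (orientation B P) (orientation B F * ExteriorAlgebra.ι ℝ v)}

/-- The target of `P`: the same with an outer-pointing vector. -/
def target (B : Frame d) (P : Set (E d)) : Set (Set (E d)) :=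
  {F | F ∈ facets P ∧ ∃ v ∈ Lin P, ∃ n ∈ normalCone P F, 0 < n v ∧
    OrientEquiv (orientation B P) (orientation B F * ExteriorAlgebra.ι ℝ v)}

/-- The `k`-boundary of `P` (for `k < dim P`): the `k`-faces that `π_{k+1}` maps to facets of
`π_{k+1}(P)`. -/
def boundaryAt (B : Frame d) (k : ℕ) (P : Set (E d)) : Set (Set (E d)) :=
  {F | F ∈ faces k P ∧ proj B (k + 1) '' F ∈ facets (proj B (k + 1) '' P)}

/-- The `k`-source of `P` (for `k < dim P`). The polytope `π_{k+1}(P)` lies in `V_{k+1}` and is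
framed there by `(v₁, …, v_{k+1})`; as a subset of `ℝ^d` with the whole frame `B` it has the same
faces, projections, induced orientations and signs of normal covectors. -/
def sourceAt (B : Frame d) (k : ℕ) (P : Set (E d)) : Set (Set (E d)) :=
  {F | F ∈ boundaryAt B k P ∧ proj B (k + 1) '' F ∈ source B (proj B (k + 1) '' P)}

/-- The `k`-target of `P` (for `k < dim P`). -/
def targetAt (B : Frame d) (k : ℕ) (P : Set (E d)) : Set (Set (E d)) :=
  {F | F ∈ boundaryAt B k P ∧ proj B (k + 1) '' F ∈ target B (proj B (k + 1) '' P)}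

/-! ### Cellular strings and loops -/

/-- A cellular `k`-string of the polytope `P` framed by `B`: a sequence of faces of dimension
greater than `k` such that the `k`-target of each meets the `k`-source of the next. -/
structure IsCellularString (B : Frame d) (P : Set (E d)) (k : ℕ) {m : ℕ}
    (F : Fin m → Set (E d)) : Prop where
  face : ∀ i, IsExposed ℝ P (F i)
  lt_dim : ∀ i, k < dim (F i)
  glue : ∀ i j : Fin m, (j : ℕ) = i + 1 → (targetAt B k (F i) ∩ sourceAt B k (F j)).Nonempty

/-- `P`, framed by `B`, has a cellular `k`-loop: a cellular `k`-string with a repeated face. -/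
def HasCellularLoop (B : Frame d) (P : Set (E d)) (k : ℕ) : Prop :=
  ∃ (m : ℕ) (F : Fin m → Set (E d)), IsCellularString B P k F ∧ ∃ i j, i ≠ j ∧ F i = F j

end FramedPolytope

end

noncomputable section

namespace FramedPolytope

variable {d : ℕ}

/-! ### Projections along a frame -/

/-! Write k = m + 1. By `GeneralPosition.boundaryAt_convexHull`, for a (k + 1)-simplex in general
position membership of a facet in the k-target or k-source is a matter of height in V_{k+1}: the
facet is in the target if the hyperplane spanned by its image passes above the image of the
remaining vertex in the direction of v_{k+1}, and in the source if it passes below.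

A loop therefore only needs m + 6 vertices: six points p_i, with i in ℤ/6, and m common ones, such
that the hyperplane through p_{i+1}, p_{i+2} and the common points passes above p_i and below
p_{i+3}. The six simplices on p_i, p_{i+1}, p_{i+2} and the common points then follow one another
cyclically (`GeneralPosition.hasCellularLoop`); all are faces, because every set of vertices of a
simplex spans one. The condition involves only m + 2 coordinates, is open, and is satisfied by a
planar hexagonal arrangement extended by unit vectors (`isCyclic_cyclicPoints`); here k ≥ 1 provides
the plane.

Hence a block of m + 6 Gaussian points is cyclic with probability bounded below independently of d.
There are about d / (m + 6) disjoint, independent blocks, so the probability that none is cyclic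
decays geometrically (`measure_compl_loop_le`). General position, which gives framedness, holds
almost surely because it is the nonvanishing of finitely many nonzero polynomials
(`ae_generalPosition`). -/

lemma proj_basis (B : Frame d) (k : ℕ) (i : Fin d) :
    proj B k (B i) = if (i : ℕ) < k then B i else 0 := by
  rw [proj, Module.Basis.constr_basis]

lemma proj_vec (B : Frame d) (k i : ℕ) : proj B k (vec B i) = if i < k then vec B i else 0 := by
  unfold vec
  split_ifs <;> simp_all [proj_basis]

lemma proj_comp_proj (B : Frame d) {k l : ℕ} (h : k ≤ l) (x : E d) :
    proj B k (proj B l x) = proj B k x := by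
  have : proj B k ∘ₗ proj B l = proj B k := by
    refine B.ext fun i => ?_
    by_cases hi : (i : ℕ) < l
    · simp [proj_basis, hi]
    · have hk : ¬ (i : ℕ) < k := fun hk => hi (hk.trans_le h)
      simp [proj_basis, hi, hk]
  exact LinearMap.congr_fun this x

lemma proj_mem_V (B : Frame d) (k : ℕ) (x : E d) : proj B k x ∈ V B k := by
  rw [proj, Module.Basis.constr_apply_fintype]
  refine Submodule.sum_mem _ fun i _ => Submodule.smul_mem _ _ ?_
  split_ifs with h
  · exact Submodule.subset_span ⟨i, h, rfl⟩
  · exact Submodule.zero_mem _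

lemma vec_mem_V (B : Frame d) {k i : ℕ} (h : i < k) : vec B i ∈ V B k := by
  have := proj_mem_V B k (vec B i)
  rwa [proj_vec, if_pos h] at this

lemma proj_of_mem_V (B : Frame d) {k : ℕ} {x : E d} (hx : x ∈ V B k) : proj B k x = x := by
  have : V B k ≤ LinearMap.eqLocus (proj B k) LinearMap.id := by
    refine Submodule.span_le.2 ?_
    rintro _ ⟨i, hi, rfl⟩
    simp [proj_basis, hi]
  exact this hx

lemma finrank_V (B : Frame d) {k : ℕ} (h : k ≤ d) : Module.finrank ℝ (V B k) = k := by
  have : V B k = Submodule.span ℝ (Set.range (B ∘ Fin.castLE h)) := by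
    refine congrArg _ (Set.ext fun x => ⟨?_, ?_⟩)
    · rintro ⟨i, hi, rfl⟩
      exact ⟨⟨i, hi⟩, rfl⟩
    · rintro ⟨i, rfl⟩
      exact ⟨Fin.castLE h i, i.2, rfl⟩
  rw [this, finrank_span_eq_card (B.linearIndependent.comp _ (Fin.castLE_injective h)),
    Fintype.card_fin]

/-- Two consecutive projections differ by a multiple of a frame vector. -/
lemma exists_eq_proj_add_smul_vec (B : Frame d) {k : ℕ} {x : E d} (hx : x ∈ V B (k + 1)) :
    ∃ a : ℝ, x = proj B k x + a • vec B k := by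
  induction hx using Submodule.span_induction with
  | mem x h =>
    obtain ⟨i, hi, rfl⟩ := h
    by_cases hik : (i : ℕ) < k
    · exact ⟨0, by simp [proj_basis, hik]⟩
    · obtain rfl : k = i := by omega
      exact ⟨1, by simp [proj_basis, vec]⟩
  | zero => exact ⟨0, by simp⟩
  | add x y _ _ hx hy =>
    obtain ⟨a, ha⟩ := hx
    obtain ⟨b, hb⟩ := hy
    refine ⟨a + b, ?_⟩
    conv_lhs => rw [ha, hb]
    rw [map_add]
    module
  | smul c x _ hx =>
    obtain ⟨a, ha⟩ := hx
    refine ⟨c * a, ?_⟩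
    conv_lhs => rw [ha]
    rw [map_smul]
    module

lemma lin_convexHull (s : Set (E d)) : Lin (convexHull ℝ s) = vectorSpan ℝ s := by
  rw [Lin, ← direction_affineSpan, affineSpan_convexHull, direction_affineSpan]

lemma dim_convexHull {κ : Type*} [Fintype κ] {z : κ → E d} {m : ℕ} (hz : AffineIndependent ℝ z)
    (hκ : Fintype.card κ = m + 1) : dim (convexHull ℝ (Set.range z)) = m := by
  rw [dim, lin_convexHull, hz.finrank_vectorSpan hκ]

lemma affineIndependent_of_proj (B : Frame d) {κ : Type*} {z : κ → E d} {m : ℕ}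
    (hz : AffineIndependent ℝ fun i => proj B m (z i)) : AffineIndependent ℝ z :=
  AffineIndependent.of_comp (proj B m).toAffineMap hz

/-- The image of the linear span lies in V_m and has its dimension m, so it is all of V_m;
rank-nullity then leaves no kernel. -/
lemma bijOn_proj (B : Frame d) {κ : Type*} [Fintype κ] {z : κ → E d} {m : ℕ} (hm : m ≤ d)
    (hz : AffineIndependent ℝ fun i => proj B m (z i)) (hκ : Fintype.card κ = m + 1) :
    Set.BijOn (proj B m) (Lin (convexHull ℝ (Set.range z)) : Set (E d)) (V B m : Set (E d)) := by
  rw [lin_convexHull]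
  set L := vectorSpan ℝ (Set.range z)
  have hL : Module.finrank ℝ L = m := (affineIndependent_of_proj B hz).finrank_vectorSpan hκ
  have hmap : L.map (proj B m) = vectorSpan ℝ (Set.range fun i => proj B m (z i)) := by
    have := AffineMap.map_vectorSpan (proj B m).toAffineMap (s := Set.range z)
    rw [← Set.range_comp] at this
    exact this
  have hV : L.map (proj B m) = V B m := by
    refine Submodule.eq_of_le_of_finrank_eq ?_ ?_
    · rintro _ ⟨x, -, rfl⟩
      exact proj_mem_V B m x
    · rw [hmap, hz.finrank_vectorSpan hκ, finrank_V B hm]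
  have hker : LinearMap.ker ((proj B m).domRestrict L) = ⊥ := by
    have h := LinearMap.finrank_range_add_finrank_ker ((proj B m).domRestrict L)
    rw [LinearMap.range_domRestrict, hV, finrank_V B hm, hL] at h
    exact Submodule.finrank_eq_zero.1 (by omega)
  refine ⟨fun x _ => proj_mem_V B m x, ?_, ?_⟩
  · intro x hx y hy hxy
    have := LinearMap.ker_eq_bot.1 hker (a₁ := ⟨x, hx⟩) (a₂ := ⟨y, hy⟩) hxy
    exact congrArg Subtype.val this
  · intro y hy
    rw [SetLike.mem_coe, ← hV] at hy
    exact hy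

/-! ### Orientations -/

lemma orientation_eq (B : Frame d) {F : Set (E d)} {m : ℕ} (h : dim F = m) :
    orientation B F = ExteriorAlgebra.ιMulti ℝ m fun i : Fin m => inverseProj B m F (vec B i) := by
  subst h
  rfl

lemma inverseProj_spec {B : Frame d} {m : ℕ} {F : Set (E d)}
    (h : Set.BijOn (proj B m) (Lin F : Set (E d)) (V B m : Set (E d))) {y : E d}
    (hy : y ∈ V B m) : inverseProj B m F y ∈ Lin F ∧ proj B m (inverseProj B m F y) = y := by
  have : ∃ a ∈ (Lin F : Set (E d)), proj B m a = y := h.surjOn hy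
  exact ⟨Function.invFunOn_mem this, Function.invFunOn_eq this⟩

/-- This is the vanishing of a wedge with a repeated factor, applied to the list u with v appended.
-/
lemma ι_mul_prod_mul_ι {M : Type*} [AddCommGroup M] [Module ℝ M] {n : ℕ} (u : Fin n → M) (v : M) :
    ExteriorAlgebra.ι ℝ v * ((List.ofFn fun i => ExteriorAlgebra.ι ℝ (u i)).prod *
      ExteriorAlgebra.ι ℝ v) = 0 := by
  have := ExteriorAlgebra.ι_mul_prod_list (R := ℝ) (Fin.snoc (α := fun _ => M) u v) (Fin.last n)
  rw [List.ofFn_succ', List.concat_eq_append, List.prod_append] at this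
  simpa using this

/-- Shearing the factors of a wedge product along its last factor does not change it. -/
lemma prod_ι_add_smul_mul_ι {M : Type*} [AddCommGroup M] [Module ℝ M] {n : ℕ} (u : Fin n → M)
    (a : Fin n → ℝ) (v : M) :
    (List.ofFn fun i => ExteriorAlgebra.ι ℝ (u i + a i • v)).prod * ExteriorAlgebra.ι ℝ v =
      (List.ofFn fun i => ExteriorAlgebra.ι ℝ (u i)).prod * ExteriorAlgebra.ι ℝ v := by
  induction n with
  | zero => simp
  | succ n ih =>
    rw [List.ofFn_succ, List.ofFn_succ, List.prod_cons, List.prod_cons, mul_assoc, mul_assoc,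
      ih (fun i => u i.succ) fun i => a i.succ, map_add, map_smul, add_mul, smul_mul_assoc,
      ι_mul_prod_mul_ι, smul_zero, add_zero]

/-! ### Faces of simplices -/

/-- A linear functional that is constant on some of finitely many points and smaller on the others
exposes the convex hull of the former. -/
lemma maximalLocus_convexHull (n : E d →ₗ[ℝ] ℝ) {c : ℝ} {S G : Set (E d)} (hGS : G ⊆ S)
    (hG : G.Nonempty) (hn : ∀ a ∈ G, n a = c) (hn' : ∀ a ∈ S, a ∉ G → n a < c) :
    convexHull ℝ G = {a ∈ convexHull ℝ S | ∀ b ∈ convexHull ℝ S, n b ≤ n a} := by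
  have hc : convexHull ℝ G ⊆ {a | n a = c} :=
    convexHull_min hn (convex_hyperplane n.isLinear c)
  have hle : convexHull ℝ S ⊆ {a | n a ≤ c} := by
    refine convexHull_min (fun a ha => ?_) (convex_halfSpace_le n.isLinear c)
    by_cases h : a ∈ G
    · exact (hn a h).le
    · exact (hn' a ha h).le
  -- The set on the right is convex and contains S, so a point of the hull at level c must already
  -- lie in the hull of G.
  have hcov : convexHull ℝ S ⊆ {a | n a < c ∨ a ∈ convexHull ℝ G} := by
    refine convexHull_min (fun a ha => ?_) ?_
    · by_cases h : a ∈ G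
      · exact Or.inr (subset_convexHull ℝ G h)
      · exact Or.inl (hn' a ha h)
    · rw [convex_iff_forall_pos]
      intro a ha b hb s t hs ht hst
      have key : ∀ {a}, a ∈ {a | n a < c ∨ a ∈ convexHull ℝ G} → n a ≤ c := by
        rintro a (h | h)
        · exact h.le
        · exact (hc h).le
      have hca := key ha
      have hcb := key hb
      have e : c = s * c + t * c := by rw [← add_mul, hst, one_mul]
      have es := mul_le_mul_of_nonneg_left hca hs.le
      have et := mul_le_mul_of_nonneg_left hcb ht.le
      rcases ha with ha | ha
      · left
        have := mul_lt_mul_of_pos_left ha hs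
        simp only [map_add, map_smul, smul_eq_mul]
        linarith
      · rcases hb with hb | hb
        · left
          have := mul_lt_mul_of_pos_left hb ht
          simp only [map_add, map_smul, smul_eq_mul]
          linarith
        · exact Or.inr (convex_convexHull ℝ G ha hb hs.le ht.le hst)
  obtain ⟨g, hg⟩ := hG
  refine Set.Subset.antisymm (fun a ha => ⟨convexHull_mono hGS ha, fun b hb => ?_⟩) ?_
  · exact (hle hb).trans (hc ha).ge
  · rintro a ⟨ha, hmax⟩
    have := hmax g (subset_convexHull ℝ S (hGS hg))
    rw [hn g hg] at this
    exact (hcov ha).resolve_left this.not_gt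

lemma isExposed_convexHull (n : E d →ₗ[ℝ] ℝ) {c : ℝ} {S G : Set (E d)} (hGS : G ⊆ S)
    (hn : ∀ a ∈ G, n a = c) (hn' : ∀ a ∈ S, a ∉ G → n a < c) :
    IsExposed ℝ (convexHull ℝ S) (convexHull ℝ G) := fun h =>
  ⟨n.toContinuousLinearMap,
    maximalLocus_convexHull n hGS (convexHull_nonempty_iff.1 h) hn hn'⟩

lemma eq_convexHull_of_isExposed {S F : Set (E d)}
    (hF : IsExposed ℝ (convexHull ℝ S) F) (hne : F.Nonempty) : F = convexHull ℝ (S ∩ F) := by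
  obtain ⟨l, hl⟩ := hF hne
  obtain ⟨a, ha⟩ := hne
  have ha' := ha
  rw [hl] at ha'
  have hmem : ∀ b ∈ S, b ∈ F ↔ l b = l a := by
    intro b hb
    have hb' := subset_convexHull ℝ S hb
    rw [hl]
    refine ⟨fun h => le_antisymm (ha'.2 b hb') (h.2 a ha'.1), fun h => ⟨hb', fun y hy => ?_⟩⟩
    rw [h]
    exact ha'.2 y hy
  have hlt : ∀ b ∈ S, b ∉ S ∩ F → l b < l a := by
    intro b hb hbF
    refine lt_of_le_of_ne (ha'.2 b (subset_convexHull ℝ S hb)) fun h => ?_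
    exact hbF ⟨hb, (hmem b hb).2 h⟩
  -- If no generator attained the maximum, the whole hull would lie strictly below it.
  have hnon : (S ∩ F).Nonempty := by
    by_contra hempty
    rw [Set.not_nonempty_iff_eq_empty] at hempty
    have : convexHull ℝ S ⊆ {b | l b < l a} :=
      convexHull_min (fun b hb => hlt b hb (by simp [hempty]))
        (convex_halfSpace_lt l.toLinearMap.isLinear _)
    exact lt_irrefl (l a) (this ha'.1)
  rw [maximalLocus_convexHull l.toLinearMap Set.inter_subset_left hnon
    (fun b hb => (hmem b hb.1).1 hb.2) hlt]
  exact hl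

/-- Any subset of the vertices of a full-dimensional simplex is separated from the others by a
functional that is constant on it. -/
lemma exists_functional_of_affineIndependent {x : Fin (d + 1) → E d} (hx : AffineIndependent ℝ x)
    (g : Finset (Fin (d + 1))) :
    ∃ (n : E d →ₗ[ℝ] ℝ) (c : ℝ), (∀ i ∈ g, n (x i) = c) ∧ ∀ i ∉ g, n (x i) < c := by
  classical
  have htop : affineSpan ℝ (Set.range x) = ⊤ := by
    rw [hx.affineSpan_eq_top_iff_card_eq_finrank_add_one]
    simp
  let b : AffineBasis (Fin (d + 1)) ℝ (E d) := ⟨x, hx, htop⟩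
  have hlin : ∀ i y, (b.coord i).linear y = b.coord i y - b.coord i 0 := by
    intro i y
    simpa using (b.coord i).linearMap_vsub y 0
  have hcoord : ∀ i j, b.coord i (x j) = if i = j then 1 else 0 := fun i j => b.coord_apply i j
  -- The functional is minus the sum of the barycentric coordinates of the vertices off g, taken
  -- without its constant term: vertices off g sit exactly one unit below those of g.
  have hval : ∀ j, (-∑ i ∈ gᶜ, (b.coord i).linear) (x j) =
      (∑ i ∈ gᶜ, b.coord i 0) - if j ∈ g then 0 else 1 := by
    intro j
    rw [LinearMap.neg_apply, LinearMap.sum_apply, Finset.sum_congr rfl fun i _ => hlin i (x j),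
      Finset.sum_sub_distrib, neg_sub, Finset.sum_congr rfl fun i _ => hcoord i j,
      Finset.sum_ite_eq']
    simp only [Finset.mem_compl, ite_not]
  refine ⟨-∑ i ∈ gᶜ, (b.coord i).linear, ∑ i ∈ gᶜ, b.coord i 0, fun i hi => ?_, fun i hi => ?_⟩
  · rw [hval, if_pos hi, sub_zero]
  · rw [hval, if_neg hi]
    exact sub_one_lt _

/-! ### Simplices in general position with respect to a frame -/

lemma dim_convexHull_image {ι : Type*} {z : ι → E d} {s : Finset ι} {m : ℕ}
    (hz : AffineIndependent ℝ fun i : s => z i) (hs : s.card = m + 1) :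
    dim (convexHull ℝ (z '' s)) = m := by
  rw [Set.image_eq_range]
  exact dim_convexHull hz (by simpa using hs)

lemma bijOn_proj_image (B : Frame d) {ι : Type*} {z : ι → E d} {s : Finset ι} {m : ℕ} (hm : m ≤ d)
    (hz : AffineIndependent ℝ fun i : s => proj B m (z i)) (hs : s.card = m + 1) :
    Set.BijOn (proj B m) (Lin (convexHull ℝ (z '' s)) : Set (E d)) (V B m : Set (E d)) := by
  rw [Set.image_eq_range]
  exact bijOn_proj B hm hz (by simpa using hs)

/-- The vertices of a simplex are in general position with respect to a frame if any `m + 1` of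
them stay affinely independent under the `m`-th projection. -/
def GeneralPosition (B : Frame d) (x : Fin (d + 1) → E d) : Prop :=
  ∀ (m : ℕ) (e : Fin (m + 1) ↪ Fin (d + 1)), AffineIndependent ℝ fun i => proj B m (x (e i))

namespace GeneralPosition

variable {B : Frame d} {x : Fin (d + 1) → E d}

lemma affineIndependent_proj (hx : GeneralPosition B x) {s : Finset (Fin (d + 1))} {m : ℕ}
    (hs : s.card = m + 1) : AffineIndependent ℝ fun i : s => proj B m (x i) := by
  let e := (s.equivFinOfCardEq hs).symm
  have := hx m (e.toEmbedding.trans (Function.Embedding.subtype _))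
  exact (affineIndependent_equiv e (p := fun i : s => proj B m (x i))).1 this

lemma affineIndependent_image (hx : GeneralPosition B x) {s : Finset (Fin (d + 1))} {m : ℕ}
    (hs : s.card = m + 1) : AffineIndependent ℝ fun i : s => x i :=
  affineIndependent_of_proj B (hx.affineIndependent_proj hs)

lemma affineIndependent (hx : GeneralPosition B x) : AffineIndependent ℝ x :=
  affineIndependent_of_proj B (hx d (Function.Embedding.refl _))

lemma isExposed (hx : GeneralPosition B x) {s g : Finset (Fin (d + 1))} (hgs : g ⊆ s) :
    IsExposed ℝ (convexHull ℝ (x '' s)) (convexHull ℝ (x '' g)) := by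
  obtain ⟨n, c, hn, hn'⟩ := exists_functional_of_affineIndependent hx.affineIndependent g
  refine isExposed_convexHull n (c := c) (Set.image_mono (by exact_mod_cast hgs)) ?_ ?_
  · rintro _ ⟨i, hi, rfl⟩
    exact hn i hi
  · rintro _ ⟨i, -, rfl⟩ hi
    exact hn' i fun h => hi ⟨i, h, rfl⟩

lemma isExposed_range (hx : GeneralPosition B x) (g : Finset (Fin (d + 1))) :
    IsExposed ℝ (convexHull ℝ (Set.range x)) (convexHull ℝ (x '' g)) := by
  simpa using hx.isExposed (Finset.subset_univ g)

/-- Simplices with vertices in general position are framed. -/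
theorem isFramed (hx : GeneralPosition B x) : IsFramed B (convexHull ℝ (Set.range x)) := by
  classical
  refine ⟨⟨Finset.univ.image x, by simp⟩, ?_⟩
  rintro k F ⟨hF, hne, hdim⟩
  let s : Finset (Fin (d + 1)) := {i | x i ∈ F}
  have hFs : F = convexHull ℝ (x '' s) := by
    have := eq_convexHull_of_isExposed hF hne
    rw [this]
    congr 1
    ext y
    constructor
    · rintro ⟨⟨i, rfl⟩, hi⟩
      exact ⟨i, by simpa [s] using hi, rfl⟩
    · rintro ⟨i, hi, rfl⟩
      exact ⟨⟨i, rfl⟩, by simpa [s] using hi⟩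
  -- Nonemptiness of the face keeps the truncated subtraction honest.
  have hs : s.card = (s.card - 1) + 1 := by
    have : s.Nonempty := by
      rw [hFs] at hne
      simpa using hne
    have := this.card_pos
    omega
  have hk : s.card - 1 = k := by
    rw [← hdim, hFs, dim_convexHull_image (hx.affineIndependent_image hs) hs]
  rw [hk] at hs
  have hcard : s.card ≤ d + 1 := by simpa using s.card_le_univ
  rw [hFs]
  exact bijOn_proj_image B (by omega) (hx.affineIndependent_proj hs) hs

/-- A functional exposing the projection of a `k`-face of a `(k + 1)`-simplex puts that face into
the `k`-boundary, where the orientations differ by the last frame vector. -/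
theorem boundaryAt_convexHull (hx : GeneralPosition B x) {k : ℕ} (hk : k + 1 ≤ d)
    {s g : Finset (Fin (d + 1))} (hgs : g ⊆ s) (hg : g.card = k + 1) (hs : s.card = k + 2)
    (n : E d →ₗ[ℝ] ℝ) {c : ℝ} (hn : ∀ i ∈ g, n (proj B (k + 1) (x i)) = c)
    (hn' : ∀ i ∈ s, i ∉ g → n (proj B (k + 1) (x i)) < c) :
    convexHull ℝ (x '' g) ∈ boundaryAt B k (convexHull ℝ (x '' s)) ∧
    LinearMap.toContinuousLinearMap n ∈ normalCone (proj B (k + 1) '' convexHull ℝ (x '' s))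
      (proj B (k + 1) '' convexHull ℝ (x '' g)) ∧
    vec B k ∈ Lin (proj B (k + 1) '' convexHull ℝ (x '' s)) ∧
    orientation B (proj B (k + 1) '' convexHull ℝ (x '' s)) =
      orientation B (proj B (k + 1) '' convexHull ℝ (x '' g)) * ExteriorAlgebra.ι ℝ (vec B k) := by
  let z : Fin (d + 1) → E d := fun i => proj B (k + 1) (x i)
  have himage : ∀ t : Finset (Fin (d + 1)),
      proj B (k + 1) '' convexHull ℝ (x '' t) = convexHull ℝ (z '' t) := by
    intro t
    rw [LinearMap.image_convexHull, Set.image_image]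
  rw [himage s, himage g]
  have hgne : g.Nonempty := Finset.card_pos.1 (by omega)
  have hzs : AffineIndependent ℝ fun i : s => z i := hx.affineIndependent_proj hs
  have hzs' : AffineIndependent ℝ fun i : s => proj B (k + 1) (z i) := by
    simpa only [z, proj_comp_proj B le_rfl] using hzs
  have hzg : AffineIndependent ℝ fun i : g => proj B k (z i) := by
    simpa only [z, proj_comp_proj B k.le_succ] using hx.affineIndependent_proj hg
  have hdims : dim (convexHull ℝ (z '' s)) = k + 1 := dim_convexHull_image hzs hs
  have hdimg : dim (convexHull ℝ (z '' g)) = k :=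
    dim_convexHull_image (affineIndependent_of_proj B hzg) hg
  have hsub : z '' g ⊆ z '' s := Set.image_mono (by exact_mod_cast hgs)
  have hnz : ∀ a ∈ z '' g, n a = c := by
    rintro _ ⟨i, hi, rfl⟩
    exact hn i hi
  have hnz' : ∀ a ∈ z '' s, a ∉ z '' g → n a < c := by
    rintro _ ⟨i, hi, rfl⟩ hig
    exact hn' i hi fun h => hig ⟨i, h, rfl⟩
  have hne : (z '' g).Nonempty := by simpa using hgne
  have hbs := bijOn_proj_image B hk hzs' hs
  have hbg := bijOn_proj_image B (k.le_succ.trans hk) hzg hg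
  have hLV : ∀ y ∈ Lin (convexHull ℝ (z '' s)), y ∈ V B (k + 1) := by
    intro y hy
    have hmem : convexHull ℝ (z '' s) ⊆ V B (k + 1) := by
      refine convexHull_min ?_ (V B (k + 1)).convex
      rintro _ ⟨i, -, rfl⟩
      exact proj_mem_V B _ _
    have hle : Lin (convexHull ℝ (z '' s)) ≤ V B (k + 1) := by
      refine Submodule.span_le.2 ?_
      rintro _ ⟨a, ha, b, hb, rfl⟩
      exact (V B (k + 1)).sub_mem (hmem ha) (hmem hb)
    exact hle hy
  -- The projected simplex lives in V_{k+1}, where π_{k+1} is the identity; its orientation is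
  -- therefore v_1 ∧ … ∧ v_{k+1}.
  have hσs : ∀ i : Fin (k + 1),
      inverseProj B (k + 1) (convexHull ℝ (z '' s)) (vec B i) = vec B i := by
    intro i
    obtain ⟨h1, h2⟩ := inverseProj_spec hbs (vec_mem_V B i.2)
    rwa [proj_of_mem_V B (hLV _ h1)] at h2
  have hvec : vec B k ∈ Lin (convexHull ℝ (z '' s)) := by
    have := (inverseProj_spec hbs (vec_mem_V B k.lt_succ_self)).1
    have h := hσs (Fin.last k)
    rw [Fin.val_last] at h
    rwa [h] at this
  have hmono : Lin (convexHull ℝ (z '' g)) ≤ Lin (convexHull ℝ (z '' s)) :=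
    vectorSpan_mono ℝ (convexHull_mono hsub)
  -- The lifts to the facet are shears of the frame vectors along v_{k+1}, which is `vec B k` in
  -- zero-based indexing. Wedging with v_{k+1} removes the shears.
  have hσg : ∀ i : Fin k, ∃ a : ℝ,
      inverseProj B k (convexHull ℝ (z '' g)) (vec B i) = vec B i + a • vec B k := by
    intro i
    obtain ⟨h1, h2⟩ := inverseProj_spec hbg (vec_mem_V B i.2)
    obtain ⟨a, ha⟩ := exists_eq_proj_add_smul_vec B (hLV _ (hmono h1))
    rw [h2] at ha
    exact ⟨a, ha⟩
  choose a ha using hσg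
  refine ⟨⟨⟨hx.isExposed hgs, by simpa using hgne,
    dim_convexHull_image (hx.affineIndependent_image hg) hg⟩, ?_⟩, ?_, hvec, ?_⟩
  · rw [himage s, himage g]
    exact ⟨isExposed_convexHull n hsub hnz hnz', hne.convexHull, by rw [hdims, hdimg]⟩
  · exact maximalLocus_convexHull n hsub hne hnz hnz'
  · rw [orientation_eq B hdims, orientation_eq B hdimg, ExteriorAlgebra.ιMulti_apply,
      ExteriorAlgebra.ιMulti_apply, List.ofFn_succ', List.concat_eq_append, List.prod_append,
      List.prod_singleton]
    simp only [hσs, ha, prod_ι_add_smul_mul_ι]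
    rfl

/-- A facet is in the target if the vertices off it lie below its hyperplane. -/
theorem mem_targetAt (hx : GeneralPosition B x) {k : ℕ} (hk : k + 1 ≤ d)
    {s g : Finset (Fin (d + 1))} (hgs : g ⊆ s) (hg : g.card = k + 1) (hs : s.card = k + 2)
    (n : E d →ₗ[ℝ] ℝ) {c : ℝ} (hn : ∀ i ∈ g, n (proj B (k + 1) (x i)) = c)
    (hn' : ∀ i ∈ s, i ∉ g → n (proj B (k + 1) (x i)) < c) (hv : 0 < n (vec B k)) :
    convexHull ℝ (x '' g) ∈ targetAt B k (convexHull ℝ (x '' s)) := by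
  obtain ⟨h1, h2, h3, h4⟩ := hx.boundaryAt_convexHull hk hgs hg hs n hn hn'
  exact ⟨h1, h1.2, vec B k, h3, _, h2, hv, 1, one_pos, by rw [one_smul, h4]⟩

/-- A facet is in the source if the vertices off it lie above its hyperplane. -/
theorem mem_sourceAt (hx : GeneralPosition B x) {k : ℕ} (hk : k + 1 ≤ d)
    {s g : Finset (Fin (d + 1))} (hgs : g ⊆ s) (hg : g.card = k + 1) (hs : s.card = k + 2)
    (n : E d →ₗ[ℝ] ℝ) {c : ℝ} (hn : ∀ i ∈ g, n (proj B (k + 1) (x i)) = c)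
    (hn' : ∀ i ∈ s, i ∉ g → n (proj B (k + 1) (x i)) < c) (hv : n (vec B k) < 0) :
    convexHull ℝ (x '' g) ∈ sourceAt B k (convexHull ℝ (x '' s)) := by
  obtain ⟨h1, h2, h3, h4⟩ := hx.boundaryAt_convexHull hk hgs hg hs n hn hn'
  exact ⟨h1, h1.2, vec B k, h3, _, h2, hv, 1, one_pos, by rw [one_smul, h4]⟩

end GeneralPosition

/-! ### The canonical frame -/

lemma canonicalFrame_apply (i : Fin d) : canonicalFrame d i = EuclideanSpace.single i 1 := by
  simp [canonicalFrame]

lemma proj_canonicalFrame_apply (k : ℕ) (x : E d) (i : Fin d) :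
    proj (canonicalFrame d) k x i = if (i : ℕ) < k then x i else 0 := by
  have h : ∀ j : Fin d, (if (j : ℕ) < k then canonicalFrame d j else 0) i =
      if j = i then (if (i : ℕ) < k then (1 : ℝ) else 0) else 0 := by
    intro j
    by_cases hji : j = i
    · subst hji
      split_ifs <;> simp_all [canonicalFrame_apply]
    · split_ifs <;> simp_all [canonicalFrame_apply, Ne.symm hji]
  rw [proj, Module.Basis.constr_apply_fintype]
  simp only [WithLp.ofLp_sum, WithLp.ofLp_smul, Finset.sum_apply, Pi.smul_apply, h, smul_eq_mul,
    mul_ite, mul_one, mul_zero, Finset.sum_ite_eq', Finset.mem_univ, if_true]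
  simp [canonicalFrame]

/-! ### A configuration of points with a loop

The coordinates that matter are split into two, the first one and the vertical one, and the
`m` coordinates in between. -/

/-- The coordinates `0` and `m + 1`, followed by the coordinates `1, …, m`. -/
def coord {m : ℕ} (h : m + 2 ≤ d) : Fin 2 ⊕ Fin m → Fin d :=
  Sum.elim ![⟨0, by omega⟩, ⟨m + 1, by omega⟩] fun j => ⟨j + 1, by omega⟩

lemma coord_lt {m : ℕ} (h : m + 2 ≤ d) (b : Fin 2 ⊕ Fin m) : (coord h b : ℕ) < m + 2 := by
  rcases b with b | j
  · fin_cases b <;> simp [coord]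
  · simp only [coord, Sum.elim_inr]
    omega

lemma coord_injective {m : ℕ} (h : m + 2 ≤ d) : Function.Injective (coord h) := by
  rintro (a | i) (b | j) hab
  · fin_cases a <;> fin_cases b <;> simp_all [coord]
  · have := j.2
    fin_cases a <;> simp [coord] at hab
    omega
  · have := i.2
    fin_cases b <;> simp [coord] at hab
    omega
  · simp only [coord, Sum.elim_inr, Fin.mk.injEq, add_left_inj] at hab
    rw [Fin.ext hab]

/-- Homogeneous coordinates. -/
def homogenize {m : ℕ} (c : ℝ) (v : Fin 2 ⊕ Fin m → ℝ) : Fin 3 ⊕ Fin m → ℝ :=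
  Sum.elim ![c, v (Sum.inl 0), v (Sum.inl 1)] fun j => v (Sum.inr j)

/-- The vertical direction. -/
def up (m : ℕ) : Fin 2 ⊕ Fin m → ℝ := Sum.elim ![0, 1] 0

/-- The points indexed by `a`, `b` and `Fin m`, in homogeneous coordinates. -/
def edgeMatrix {m : ℕ} (Y : Fin 6 ⊕ Fin m → Fin 2 ⊕ Fin m → ℝ) (a b : Fin 6) :
    Matrix (Fin 3 ⊕ Fin m) (Fin 3 ⊕ Fin m) ℝ :=
  Matrix.of (Sum.elim
    ![homogenize 1 (Y (Sum.inl a)), homogenize 1 (Y (Sum.inl b)), 0]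
    fun j => homogenize 1 (Y (Sum.inr j)))

/-- The equation of the hyperplane through the points indexed by `a`, `b` and `Fin m`. -/
def edgeFunctional {m : ℕ} (Y : Fin 6 ⊕ Fin m → Fin 2 ⊕ Fin m → ℝ) (a b : Fin 6) :
    (Fin 3 ⊕ Fin m → ℝ) →ₗ[ℝ] ℝ :=
  LinearMap.proj (Sum.inl 2) ∘ₗ (edgeMatrix Y a b).transpose.cramer

/-- By Cramer's rule: the zero row of `edgeMatrix` is a placeholder for the point being tested. The
determinant vanishes at the other rows, since a row is then repeated. -/
lemma edgeFunctional_apply {m : ℕ} (Y : Fin 6 ⊕ Fin m → Fin 2 ⊕ Fin m → ℝ) (a b : Fin 6)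
    (v : Fin 3 ⊕ Fin m → ℝ) :
    edgeFunctional Y a b v = ((edgeMatrix Y a b).updateRow (Sum.inl 2) v).det :=
  Matrix.cramer_transpose_apply _ _ _

lemma edgeFunctional_row {m : ℕ} (Y : Fin 6 ⊕ Fin m → Fin 2 ⊕ Fin m → ℝ) (a b : Fin 6)
    {r : Fin 3 ⊕ Fin m} (hr : r ≠ Sum.inl 2) : edgeFunctional Y a b (edgeMatrix Y a b r) = 0 := by
  rw [edgeFunctional, LinearMap.comp_apply, Matrix.cramer_transpose_row_self]
  exact Pi.single_eq_of_ne hr.symm _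

/-- The six points indexed by `Fin 6` are such that the hyperplane through the `i + 1`-st, the
`i + 2`-nd and the points indexed by `Fin m` passes above the `i`-th and below the `i + 3`-rd. -/
def IsCyclic {m : ℕ} (Y : Fin 6 ⊕ Fin m → Fin 2 ⊕ Fin m → ℝ) : Prop :=
  ∀ i : Fin 6,
    edgeFunctional Y (i + 1) (i + 2) (homogenize 0 (up m)) *
      edgeFunctional Y (i + 1) (i + 2) (homogenize 1 (Y (Sum.inl i))) < 0 ∧
    0 < edgeFunctional Y (i + 1) (i + 2) (homogenize 0 (up m)) *
      edgeFunctional Y (i + 1) (i + 2) (homogenize 1 (Y (Sum.inl (i + 3))))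

lemma continuous_homogenize {m : ℕ} {T : Type*} [TopologicalSpace T]
    {f : T → Fin 2 ⊕ Fin m → ℝ} (hf : Continuous f) (c : ℝ) :
    Continuous fun t => homogenize c (f t) := by
  refine continuous_pi fun r => ?_
  rcases r with r | j
  · fin_cases r <;> simp [homogenize] <;> fun_prop
  · simp only [homogenize, Sum.elim_inr]
    fun_prop

lemma continuous_edgeFunctional {m : ℕ} (a b : Fin 6)
    {f : (Fin 6 ⊕ Fin m → Fin 2 ⊕ Fin m → ℝ) → Fin 3 ⊕ Fin m → ℝ} (hf : Continuous f) :
    Continuous fun Y => edgeFunctional Y a b (f Y) := by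
  simp only [edgeFunctional_apply]
  refine (Continuous.matrix_updateRow _ ?_ hf).matrix_det
  refine continuous_pi fun r => ?_
  rcases r with r | j
  · fin_cases r
    · exact continuous_homogenize (continuous_apply _) 1
    · exact continuous_homogenize (continuous_apply _) 1
    · exact continuous_const
  · exact continuous_homogenize (continuous_apply _) 1

lemma isOpen_isCyclic (m : ℕ) :
    IsOpen {Y : Fin 6 ⊕ Fin m → Fin 2 ⊕ Fin m → ℝ | IsCyclic Y} := by
  simp only [IsCyclic, Set.ofPred_forall]
  refine isOpen_iInter_of_finite fun i => ?_
  refine IsOpen.and (isOpen_lt ?_ continuous_const) (isOpen_lt continuous_const ?_)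
  · exact (continuous_edgeFunctional _ _ continuous_const).mul
      (continuous_edgeFunctional _ _ (continuous_homogenize (continuous_apply _) 1))
  · exact (continuous_edgeFunctional _ _ continuous_const).mul
      (continuous_edgeFunctional _ _ (continuous_homogenize (continuous_apply _) 1))

/-- Six points of a plane, and the endpoints of the other coordinate vectors. -/
def cyclicPoints (m : ℕ) : Fin 6 ⊕ Fin m → Fin 2 ⊕ Fin m → ℝ :=
  Sum.elim
    (fun i => Sum.elim ![(![10, -10, -8, -10, 10, 8] : Fin 6 → ℝ) i,
      (![10, -10, 0, 10, -10, 0] : Fin 6 → ℝ) i] 0)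
    fun j => Pi.single (Sum.inr j) 1

/-- The planar points have no middle coordinates and the other m points are unit vectors there, so
the matrix is block triangular and only the planar 3 × 3 determinant survives. -/
lemma edgeFunctional_cyclicPoints (m : ℕ) (a b : Fin 6) (c : ℝ) (u : Fin 2 → ℝ) :
    edgeFunctional (cyclicPoints m) a b (homogenize c (Sum.elim u 0)) =
      Matrix.det !![1, cyclicPoints m (Sum.inl a) (Sum.inl 0), cyclicPoints m (Sum.inl a) (Sum.inl 1);
        1, cyclicPoints m (Sum.inl b) (Sum.inl 0), cyclicPoints m (Sum.inl b) (Sum.inl 1);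
        c, u 0, u 1] := by
  have h : (edgeMatrix (cyclicPoints m) a b).updateRow (Sum.inl 2) (homogenize c (Sum.elim u 0)) =
      Matrix.fromBlocks
        !![1, cyclicPoints m (Sum.inl a) (Sum.inl 0), cyclicPoints m (Sum.inl a) (Sum.inl 1);
        1, cyclicPoints m (Sum.inl b) (Sum.inl 0), cyclicPoints m (Sum.inl b) (Sum.inl 1);
        c, u 0, u 1] 0 (Matrix.of fun _ => ![1, 0, 0]) 1 := by
    ext r s
    rcases r with r | i
    · rcases s with s | j
      · fin_cases r <;> fin_cases s <;>
          simp [edgeMatrix, Matrix.updateRow_apply, homogenize]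
      · fin_cases r <;> simp [edgeMatrix, Matrix.updateRow_apply, homogenize, cyclicPoints]
    · rcases s with s | j
      · fin_cases s <;> simp [edgeMatrix, Matrix.updateRow_apply, homogenize, cyclicPoints]
      · simp [edgeMatrix, Matrix.updateRow_apply, homogenize, cyclicPoints, Matrix.one_apply,
          Pi.single_apply, eq_comm]
  rw [edgeFunctional_apply, h, Matrix.det_fromBlocks_zero₁₂, Matrix.det_one, mul_one]

/-- In the plane, p_{i+3} is the mirror image of p_i in the vertical axis, which preserves above and
below. The lines p_1p_2, p_2p_3, p_3p_4 have slopes 5, -5, -1 and pass above p_0, p_1, p_2 and below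
p_3, p_4, p_5; the other three are their reflections. -/
lemma isCyclic_cyclicPoints (m : ℕ) : IsCyclic (cyclicPoints m) := by
  have h : ∀ i, cyclicPoints m (Sum.inl i) = Sum.elim
      ![cyclicPoints m (Sum.inl i) (Sum.inl 0), cyclicPoints m (Sum.inl i) (Sum.inl 1)] 0 := by
    intro i
    simp [cyclicPoints]
  intro i
  rw [h i, h (i + 3), up]
  simp only [edgeFunctional_cyclicPoints, Matrix.det_fin_three]
  fin_cases i <;> simp [cyclicPoints] <;> norm_num [Fin.ext_iff]

lemma exists_forall_isCyclic (m : ℕ) : ∃ ε > 0, ∀ Y : Fin 6 ⊕ Fin m → Fin 2 ⊕ Fin m → ℝ,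
    (∀ a b, dist (Y a b) (cyclicPoints m a b) < ε) → IsCyclic Y := by
  obtain ⟨ε, hε, h⟩ := Metric.isOpen_iff.1 (isOpen_isCyclic m) _ (isCyclic_cyclicPoints m)
  refine ⟨ε, hε, fun Y hY => h ?_⟩
  rw [Metric.mem_ball, dist_pi_lt_iff hε]
  intro a
  rw [dist_pi_lt_iff hε]
  exact hY a

/-! ### Loops -/

section Loop

variable {m : ℕ}

/-- The vertices of a simplex indexed by a subset of `Fin 6` and by `Fin m`. -/
def join (τ : Fin 6 ⊕ Fin m ↪ Fin (d + 1)) (t : Finset (Fin 6)) : Finset (Fin (d + 1)) :=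
  (t.disjSum Finset.univ).map τ

lemma card_join (τ : Fin 6 ⊕ Fin m ↪ Fin (d + 1)) (t : Finset (Fin 6)) :
    (join τ t).card = t.card + m := by
  simp [join]

lemma join_mono (τ : Fin 6 ⊕ Fin m ↪ Fin (d + 1)) {s t : Finset (Fin 6)} (h : s ⊆ t) :
    join τ s ⊆ join τ t :=
  Finset.map_subset_map.2 (Finset.disjSum_mono h subset_rfl)

/-- The selected coordinates of the selected points. -/
def selectedCoords (h : m + 2 ≤ d) (τ : Fin 6 ⊕ Fin m ↪ Fin (d + 1)) (x : Fin (d + 1) → E d) :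
    Fin 6 ⊕ Fin m → Fin 2 ⊕ Fin m → ℝ :=
  fun a b => x (τ a) (coord h b)

/-- The linear part of an affine functional in homogeneous coordinates. -/
def linearPart (h : m + 2 ≤ d) (N : (Fin 3 ⊕ Fin m → ℝ) →ₗ[ℝ] ℝ) : E d →ₗ[ℝ] ℝ where
  toFun z := N (homogenize 0 fun b => z (coord h b))
  map_add' y z := by
    rw [← map_add]
    congr 1
    ext r
    rcases r with r | j
    · fin_cases r <;> simp [homogenize]
    · simp [homogenize]
  map_smul' c z := by
    rw [RingHom.id_apply, ← map_smul]
    congr 1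
    ext r
    rcases r with r | j
    · fin_cases r <;> simp [homogenize]
    · simp [homogenize]

/-- π_{m+2} keeps every selected coordinate, so only the value of the affine functional at the
origin is lost. That value is the offset in the constants c chosen in the loop construction. -/
lemma linearPart_proj (h : m + 2 ≤ d) (N : (Fin 3 ⊕ Fin m → ℝ) →ₗ[ℝ] ℝ) (z : E d) :
    linearPart h N (proj (canonicalFrame d) (m + 2) z) =
      N (homogenize 1 fun b => z (coord h b)) - N (homogenize 1 0) := by
  rw [← map_sub]
  simp only [linearPart, LinearMap.coe_mk, AddHom.coe_mk, proj_canonicalFrame_apply,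
    if_pos (coord_lt h _)]
  congr 1
  ext r
  rcases r with r | j
  · fin_cases r <;> simp [homogenize]
  · simp [homogenize]

lemma linearPart_vec (h : m + 2 ≤ d) (N : (Fin 3 ⊕ Fin m → ℝ) →ₗ[ℝ] ℝ) :
    linearPart h N (vec (canonicalFrame d) (m + 1)) = N (homogenize 0 (up m)) := by
  have hc : vec (canonicalFrame d) (m + 1) =
      EuclideanSpace.single (coord h (Sum.inl 1)) (1 : ℝ) := by
    rw [vec, dif_pos (by omega : m + 1 < d), canonicalFrame_apply]
    rfl
  simp only [linearPart, LinearMap.coe_mk, AddHom.coe_mk, hc]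
  congr 2
  ext b
  rw [PiLp.single_apply]
  simp only [(coord_injective h).eq_iff]
  rcases b with b | j
  · fin_cases b <;> simp [up]
  · simp [up]

/-- A cyclic configuration of vertices gives a loop of simplices. -/
theorem GeneralPosition.hasCellularLoop (h : m + 2 ≤ d) {x : Fin (d + 1) → E d}
    (hx : GeneralPosition (canonicalFrame d) x) (τ : Fin 6 ⊕ Fin m ↪ Fin (d + 1))
    (hY : IsCyclic (selectedCoords h τ x)) :
    HasCellularLoop (canonicalFrame d) (convexHull ℝ (Set.range x)) (m + 1) := by
  set Y := selectedCoords h τ x with hYdef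
  have hcard2 : ∀ i : Fin 6, (join τ {i + 1, i + 2}).card = m + 1 + 1 := by
    intro i
    have : ({i + 1, i + 2} : Finset (Fin 6)).card = 2 := by decide +revert
    rw [card_join, this]
    omega
  have hcard3 : ∀ i : Fin 6, (join τ {i, i + 1, i + 2}).card = m + 1 + 2 := by
    intro i
    have : ({i, i + 1, i + 2} : Finset (Fin 6)).card = 3 := by decide +revert
    rw [card_join, this]
    omega
  have hmem : ∀ {t : Finset (Fin 6)} {j}, j ∈ join τ t ↔
      (∃ i ∈ t, τ (Sum.inl i) = j) ∨ ∃ i, τ (Sum.inr i) = j := by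
    intro t j
    simp [join]
  have hzero : ∀ i : Fin 6, ∀ j ∈ join τ {i + 1, i + 2},
      edgeFunctional Y (i + 1) (i + 2) (homogenize 1 fun b => x j (coord h b)) = 0 := by
    intro i j hj
    rcases hmem.1 hj with ⟨l, hl, rfl⟩ | ⟨l, rfl⟩
    · rcases Finset.mem_insert.1 hl with rfl | hl
      · exact edgeFunctional_row Y (i + 1) (i + 2) (r := Sum.inl 0) (by simp)
      · rw [Finset.mem_singleton.1 hl]
        exact edgeFunctional_row Y (i + 1) (i + 2) (r := Sum.inl 1) (by simp)
    · exact edgeFunctional_row Y (i + 1) (i + 2) (r := Sum.inr l) (by simp)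
  have hup : ∀ i : Fin 6, edgeFunctional Y (i + 1) (i + 2) (homogenize 0 (up m)) ≠ 0 := by
    intro i h0
    have := (hY i).1
    rw [h0, zero_mul] at this
    exact lt_irrefl _ this
  have htarget : ∀ i : Fin 6, convexHull ℝ (x '' join τ {i + 1, i + 2}) ∈
      targetAt (canonicalFrame d) (m + 1) (convexHull ℝ (x '' join τ {i, i + 1, i + 2})) := by
    intro i
    -- The sign of the determinant depends on the order of its rows; scaling by its value on the
    -- vertical direction makes N positive there, as a square.
    let N := edgeFunctional Y (i + 1) (i + 2) (homogenize 0 (up m)) •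
      edgeFunctional Y (i + 1) (i + 2)
    refine hx.mem_targetAt (by omega) (join_mono τ (by simp)) (hcard2 i) (hcard3 i)
      (linearPart h N) (c := 0 - N (homogenize 1 0)) (fun j hj => ?_) (fun j hj hj' => ?_) ?_
    · rw [linearPart_proj]
      simp only [N, LinearMap.smul_apply, hzero i j hj, smul_zero]
    · obtain rfl : τ (Sum.inl i) = j := by
        rw [hmem] at hj hj'
        simp_all
      rw [linearPart_proj]
      exact sub_lt_sub_right (hY i).1 _
    · rw [linearPart_vec]
      exact mul_self_pos.2 (hup i)
  have hsource : ∀ i : Fin 6, convexHull ℝ (x '' join τ {i + 1, i + 2}) ∈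
      sourceAt (canonicalFrame d) (m + 1)
        (convexHull ℝ (x '' join τ {i + 1, i + 1 + 1, i + 1 + 2})) := by
    intro i
    -- The same hyperplane seen from the next simplex: its remaining vertex i + 3 lies above, so the
    -- outer normal points down.
    let N := -(edgeFunctional Y (i + 1) (i + 2) (homogenize 0 (up m)) •
      edgeFunctional Y (i + 1) (i + 2))
    have h2 : i + 1 + 1 = i + 2 := by rw [add_assoc]; rfl
    have h3 : i + 1 + 2 = i + 3 := by rw [add_assoc]; rfl
    have hc := hcard3 (i + 1)
    rw [h2, h3] at hc ⊢
    refine hx.mem_sourceAt (by omega) (join_mono τ (by simp [Finset.insert_subset_iff]))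
      (hcard2 i) hc
      (linearPart h N) (c := 0 - N (homogenize 1 0)) (fun j hj => ?_) (fun j hj hj' => ?_) ?_
    · rw [linearPart_proj]
      simp only [N, LinearMap.neg_apply, LinearMap.smul_apply, hzero i j hj, smul_zero, neg_zero]
    · obtain rfl : τ (Sum.inl (i + 3)) = j := by
        rw [hmem] at hj hj'
        simp_all
      rw [linearPart_proj]
      exact sub_lt_sub_right (neg_neg_of_pos (hY i).2) _
    · rw [linearPart_vec]
      exact neg_neg_of_pos (mul_self_pos.2 (hup i))
  -- Seven terms, so that the last simplex is the first one again.
  refine ⟨7, fun j => convexHull ℝ (x '' join τ {Fin.ofNat 6 j, Fin.ofNat 6 j + 1,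
    Fin.ofNat 6 j + 2}), ⟨fun j => hx.isExposed_range _, fun j => ?_, fun i j hij => ?_⟩,
    0, 6, by decide, rfl⟩
  · rw [dim_convexHull_image (hx.affineIndependent_image (hcard3 _)) (hcard3 _)]
    omega
  · refine ⟨_, htarget (Fin.ofNat 6 i), ?_⟩
    have : Fin.ofNat 6 j = Fin.ofNat 6 i + 1 := by
      rw [hij]
      ext
      simp [Fin.val_add]
    simp only [this]
    exact hsource _

end Loop

/-! ### Product measures -/

lemma measurable_mvPolynomial_eval {n : ℕ} (p : MvPolynomial (Fin n) ℝ) :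
    Measurable fun z : Fin n → ℝ => MvPolynomial.eval z p :=
  (MvPolynomial.continuous_eval p).measurable

/-- Induction on the number of variables: `finSuccEquiv` views p as a polynomial in variable 0.
Almost surely its leading coefficient does not vanish at the other variables, which leaves finitely
many roots, a null set for ν. -/
theorem ae_pi_fin_eval_ne_zero (ν : Measure ℝ) [IsProbabilityMeasure ν] [NullSingletonClass ν] {n : ℕ}
    {p : MvPolynomial (Fin n) ℝ} (hp : p ≠ 0) :
    ∀ᵐ z ∂Measure.pi fun _ : Fin n => ν, MvPolynomial.eval z p ≠ 0 := by
  induction n with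
  | zero =>
    refine Eventually.of_forall fun z => ?_
    rw [MvPolynomial.eq_C_of_isEmpty p] at hp ⊢
    rw [MvPolynomial.eval_C]
    exact fun h => hp (by rw [h, map_zero])
  | succ n ih =>
    have hcons : Continuous fun y : (Fin n → ℝ) × ℝ => (Fin.cons y.2 y.1 : Fin (n + 1) → ℝ) :=
      continuous_pi fun i => by
        refine Fin.cases ?_ (fun j => ?_) i
        · simpa using continuous_snd
        · simpa using! (continuous_apply j).comp continuous_fst
    have hmeas : MeasurableSet {y : (Fin n → ℝ) × ℝ |
        MvPolynomial.eval (Fin.cons y.2 y.1 : Fin (n + 1) → ℝ) p ≠ 0} :=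
      ((measurable_mvPolynomial_eval p).comp hcons.measurable)
        (measurableSet_singleton (0 : ℝ)).compl
    have hprod : ∀ᵐ y ∂(Measure.pi fun _ : Fin n => ν).prod ν,
        MvPolynomial.eval (Fin.cons y.2 y.1 : Fin (n + 1) → ℝ) p ≠ 0 := by
      rw [Measure.ae_prod_iff_ae_ae hmeas]
      have hlead : (MvPolynomial.finSuccEquiv ℝ n p).leadingCoeff ≠ 0 := by
        simpa using hp
      filter_upwards [ih hlead] with s hs
      have hne : (MvPolynomial.finSuccEquiv ℝ n p).map (MvPolynomial.eval s) ≠ 0 :=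
        fun h => hs (by rw [Polynomial.leadingCoeff, ← Polynomial.coeff_map, h,
          Polynomial.coeff_zero])
      rw [ae_iff]
      refine Set.Finite.measure_zero ?_ ν
      refine (Polynomial.finite_setOfPred_isRoot hne).subset fun t ht => ?_
      simp only [not_not, MvPolynomial.eval_eq_eval_mv_eval', Set.mem_ofPred_eq] at ht
      exact ht
    have h := ((Measure.measurePreserving_swap (μ := ν)
      (ν := Measure.pi fun _ : Fin n => ν)).comp
        (measurePreserving_piFinSuccAbove (fun _ : Fin (n + 1) => ν) 0)).quasiMeasurePreserving.ae
      hprod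
    filter_upwards [h] with z hz
    have hz' : (Fin.cons (z 0) (fun j => z (Fin.succAbove 0 j)) : Fin (n + 1) → ℝ) = z :=
      Fin.cons_self_tail z
    rw [← hz']
    exact hz

lemma measurePreserving_uncurry {ι κ T : Type*} [Fintype ι] [Fintype κ] [MeasurableSpace T]
    (ν : Measure T) [IsProbabilityMeasure ν] :
    MeasurePreserving (fun (f : ι → κ → T) (p : ι × κ) => f p.1 p.2)
      (Measure.pi fun _ => Measure.pi fun _ => ν) (Measure.pi fun _ => ν) := by
  have hm : Measurable fun (f : ι → κ → T) (p : ι × κ) => f p.1 p.2 := by fun_prop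
  refine ⟨hm, (Measure.pi_eq fun s hs => ?_).symm⟩
  have : (fun (f : ι → κ → T) (p : ι × κ) => f p.1 p.2) ⁻¹' Set.univ.pi s =
      Set.univ.pi fun i => Set.univ.pi fun j => s (i, j) := by
    ext f
    simp [Set.mem_pi]
  rw [Measure.map_apply hm (.univ_pi hs), this, Measure.pi_pi, Fintype.prod_prod_type]
  simp only [Measure.pi_pi]

lemma measurePreserving_ofLp_stdGaussian (d : ℕ) :
    MeasurePreserving (fun (z : E d) (j : Fin d) => z j) (stdGaussian (E d))
      (Measure.pi fun _ => gaussianReal 0 1) := by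
  have hm : Measurable fun (z : E d) (j : Fin d) => z j := by fun_prop
  refine ⟨hm, ?_⟩
  rw [← map_pi_eq_stdGaussian, Measure.map_map hm (by fun_prop)]
  exact Measure.map_id

/-- Any selection of coordinates of a product measure is distributed as a product measure. -/
lemma hasLaw_pi_precomp {Ω : Type*} [MeasurableSpace Ω] {μ : Measure Ω}
    [IsProbabilityMeasure μ] {ι κ T : Type*} [Fintype ι] [Fintype κ] [MeasurableSpace T]
    {ν : Measure T} [IsProbabilityMeasure ν] {Z : Ω → ι → T}
    (hZ : HasLaw Z (Measure.pi fun _ => ν) μ) {f : κ → ι} (hf : Function.Injective f) :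
    HasLaw (fun ω k => Z ω (f k)) (Measure.pi fun _ => ν) μ := by
  have hm : ∀ i, HasLaw (fun ω => Z ω i) ν μ := fun i =>
    (measurePreserving_eval (fun _ => ν) i).hasLaw.comp hZ
  have hind : iIndepFun (fun i ω => Z ω i) μ := by
    rw [iIndepFun_iff_map_fun_eq_pi_map fun i => (hm i).aemeasurable]
    simp only [(hm _).map_eq]
    exact hZ.map_eq
  refine ⟨aemeasurable_pi_lambda _ fun k => (hm (f k)).aemeasurable, ?_⟩
  rw [(hind.precomp hf).map_fun_eq_pi_map fun k => (hm (f k)).aemeasurable]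
  simp only [(hm _).map_eq]

/-- The zero set of a nonzero polynomial is negligible for products of diffuse measures. -/
theorem ae_pi_eval_ne_zero {ι : Type*} [Fintype ι] (ν : Measure ℝ) [IsProbabilityMeasure ν]
    [NullSingletonClass ν] {p : MvPolynomial ι ℝ} (hp : p ≠ 0) :
    ∀ᵐ z ∂Measure.pi fun _ : ι => ν, MvPolynomial.eval z p ≠ 0 := by
  obtain ⟨n, ⟨φ⟩⟩ := Finite.exists_equiv_fin ι
  have hp' : MvPolynomial.rename φ p ≠ 0 := fun h =>
    hp (MvPolynomial.rename_injective φ φ.injective (by rw [map_zero]; exact h))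
  have hlaw := hasLaw_pi_precomp (MeasurePreserving.id (Measure.pi fun _ : ι => ν)).hasLaw
    φ.symm.injective
  have hae := ae_pi_fin_eval_ne_zero ν hp'
  rw [← hlaw.map_eq] at hae
  filter_upwards [ae_of_ae_map hlaw.aemeasurable hae] with z hz
  rw [MvPolynomial.eval_rename] at hz
  have hcomp : (fun k => id z (φ.symm k)) ∘ φ = z := by
    ext p
    simp
  rwa [hcomp] at hz

section Coordinates

variable {Ω : Type*} [MeasurableSpace Ω] {μ : Measure Ω}
  {X : Fin (d + 1) → Ω → E d}

/-- The coordinates of independent standard normal vectors are independent and standard normal. -/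
lemma hasLaw_coordinates (hlaw : ∀ i, HasLaw (X i) (stdGaussian (E d)) μ) (hindep : iIndepFun X μ) :
    HasLaw (fun ω (p : Fin (d + 1) × Fin d) => X p.1 ω p.2)
      (Measure.pi fun _ => gaussianReal 0 1) μ := by
  have h1 : HasLaw (fun ω i => X i ω) (Measure.pi fun _ : Fin (d + 1) => stdGaussian (E d)) μ := by
    refine ⟨aemeasurable_pi_lambda _ fun i => (hlaw i).aemeasurable, ?_⟩
    rw [hindep.map_fun_eq_pi_map fun i => (hlaw i).aemeasurable]
    simp only [(hlaw _).map_eq]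
  have h2 := (measurePreserving_uncurry (ι := Fin (d + 1)) (κ := Fin d) (gaussianReal 0 1)).comp
    (measurePreserving_pi (fun _ : Fin (d + 1) => stdGaussian (E d)) _
      fun _ => measurePreserving_ofLp_stdGaussian d)
  exact h2.hasLaw.comp h1

/-- The matrix of the first `m` coordinates, in homogeneous form, of `m + 1` points. -/
def genericMatrix {m : ℕ} (hm : m ≤ d) (e : Fin (m + 1) ↪ Fin (d + 1)) {R : Type*} [One R]
    (z : Fin (d + 1) × Fin d → R) : Matrix (Fin (m + 1)) (Fin (m + 1)) R :=
  Matrix.of fun i => Fin.cons 1 fun j => z (e i, Fin.castLE hm j)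

/-- An affine relation among the projected points is a left kernel vector of the matrix; the column
of ones records that its weights sum to zero. -/
lemma affineIndependent_of_det_ne_zero {m : ℕ} (hm : m ≤ d) (e : Fin (m + 1) ↪ Fin (d + 1))
    {x : Fin (d + 1) → E d} (h : (genericMatrix hm e fun p => x p.1 p.2).det ≠ 0) :
    AffineIndependent ℝ fun i => proj (canonicalFrame d) m (x (e i)) := by
  rw [affineIndependent_iff]
  intro s w hw hsum i hi
  classical
  let v : Fin (m + 1) → ℝ := fun i => if i ∈ s then w i else 0
  have hv : Matrix.vecMul v (genericMatrix hm e fun p => x p.1 p.2) = 0 := by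
    ext j
    simp only [Matrix.vecMul, dotProduct, v, ite_mul, zero_mul, Finset.sum_ite_mem,
      Finset.univ_inter, Pi.zero_apply]
    refine Fin.cases ?_ (fun j => ?_) j
    · simpa [genericMatrix] using hw
    · have := congrArg (fun y : E d => y (Fin.castLE hm j)) hsum
      simpa [genericMatrix, proj_canonicalFrame_apply] using this
  have := congrFun (Matrix.eq_zero_of_vecMul_eq_zero h hv) i
  simpa [v, hi] using this

lemma eval_det_genericMatrix {m : ℕ} (hm : m ≤ d) (e : Fin (m + 1) ↪ Fin (d + 1))
    (z : Fin (d + 1) × Fin d → ℝ) :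
    MvPolynomial.eval z (genericMatrix hm e (MvPolynomial.X (R := ℝ))).det =
      (genericMatrix hm e z).det := by
  rw [RingHom.map_det]
  congr 1
  ext i j
  refine Fin.cases ?_ (fun j => ?_) j <;> simp [genericMatrix]

/-- Placing the points on the moment curve turns the matrix into a Vandermonde matrix with distinct
nodes. -/
lemma det_genericMatrix_X_ne_zero {m : ℕ} (hm : m ≤ d) (e : Fin (m + 1) ↪ Fin (d + 1)) :
    (genericMatrix hm e (MvPolynomial.X (R := ℝ))).det ≠ 0 := by
  intro h
  let z : Fin (d + 1) × Fin d → ℝ := fun p => (p.1 : ℝ) ^ ((p.2 : ℕ) + 1)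
  have hvan : genericMatrix hm e z = Matrix.vandermonde fun i => ((e i : ℕ) : ℝ) := by
    ext i j
    refine Fin.cases ?_ (fun j => ?_) j
    · simp [genericMatrix, Matrix.vandermonde_apply]
    · simp [genericMatrix, Matrix.vandermonde_apply, z]
  have h0 := congrArg (MvPolynomial.eval z) h
  rw [eval_det_genericMatrix, hvan, map_zero] at h0
  refine Matrix.det_vandermonde_ne_zero_iff.2 ?_ h0
  exact Nat.cast_injective.comp (Fin.val_injective.comp e.injective)

theorem ae_generalPosition [IsProbabilityMeasure μ]
    (hlaw : ∀ i, HasLaw (X i) (stdGaussian (E d)) μ)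
    (hindep : iIndepFun X μ) :
    ∀ᵐ ω ∂μ, GeneralPosition (canonicalFrame d) fun i => X i ω := by
  have : NullSingletonClass (gaussianReal 0 1) := nullSingletonClass_gaussianReal one_ne_zero
  have hZ := hasLaw_coordinates hlaw hindep
  have key : ∀ (m : ℕ) (e : Fin (m + 1) ↪ Fin (d + 1)), ∀ᵐ ω ∂μ,
      AffineIndependent ℝ fun i => proj (canonicalFrame d) m (X (e i) ω) := by
    intro m e
    have hm : m ≤ d := by simpa using Fintype.card_le_of_embedding e
    have hae := ae_pi_eval_ne_zero (gaussianReal 0 1) (det_genericMatrix_X_ne_zero hm e)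
    rw [← hZ.map_eq] at hae
    refine (ae_of_ae_map hZ.aemeasurable hae).mono fun ω hω => ?_
    rw [eval_det_genericMatrix] at hω
    exact affineIndependent_of_det_ne_zero (x := fun i => X i ω) hm e hω
  have hall : ∀ᵐ ω ∂μ, ∀ (m : ℕ) (e : Fin (m + 1) ↪ Fin (d + 1)),
      AffineIndependent ℝ fun i => proj (canonicalFrame d) m (X (e i) ω) := by
    rw [ae_all_iff]
    intro m
    rw [ae_all_iff]
    exact key m
  exact hall

end Coordinates

/-! ### Disjoint blocks of points -/

/-- Disjoint blocks of points, each indexed by `Fin 6 ⊕ Fin m`. -/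
def block {m M : ℕ} (h : M * (6 + m) ≤ d + 1) :
    Fin M × (Fin 6 ⊕ Fin m) ↪ Fin (d + 1) :=
  (((Equiv.refl (Fin M)).prodCongr finSumFinEquiv).trans finProdFinEquiv).toEmbedding.trans
    (Fin.castLEEmb h)

/-- The probability that a block is not close to the cyclic configuration. -/
def farProbability (m : ℕ) (ε : ℝ) : ENNReal :=
  (Measure.pi fun _ : (Fin 6 ⊕ Fin m) × (Fin 2 ⊕ Fin m) => gaussianReal 0 1)
    {z | ∀ a b, dist (z (a, b)) (cyclicPoints m a b) < ε}ᶜ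

lemma isOpen_near (m : ℕ) (ε : ℝ) :
    IsOpen {z : (Fin 6 ⊕ Fin m) × (Fin 2 ⊕ Fin m) → ℝ |
      ∀ a b, dist (z (a, b)) (cyclicPoints m a b) < ε} := by
  simp only [Set.ofPred_forall]
  refine isOpen_iInter_of_finite fun a => isOpen_iInter_of_finite fun b => ?_
  exact isOpen_lt (by fun_prop) continuous_const

/-- The Gaussian measure charges every nonempty open set, and the cyclic configuration lies in this
one. -/
lemma farProbability_lt_one (m : ℕ) {ε : ℝ} (hε : 0 < ε) : farProbability m ε < 1 := by
  have : (gaussianReal 0 1).IsOpenPosMeasure :=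
    (gaussianReal_absolutelyContinuous' 0 one_ne_zero).isOpenPosMeasure
  have hpos := (isOpen_near m ε).measure_pos
    (Measure.pi fun _ : (Fin 6 ⊕ Fin m) × (Fin 2 ⊕ Fin m) => gaussianReal 0 1)
    ⟨fun p => cyclicPoints m p.1 p.2, fun a b => by simpa using hε⟩
  rw [farProbability, prob_compl_eq_one_sub (isOpen_near m ε).measurableSet]
  exact ENNReal.sub_lt_self ENNReal.one_ne_top one_ne_zero hpos.ne'

section Blocks

variable {Ω : Type*} [MeasurableSpace Ω] {μ : Measure Ω} [IsProbabilityMeasure μ]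
  {X : Fin (d + 1) → Ω → E d}

/-- The probability that all blocks are far from the cyclic configuration. -/
lemma measure_forall_block_far (hlaw : ∀ i, HasLaw (X i) (stdGaussian (E d)) μ)
    (hindep : iIndepFun X μ) {m M : ℕ} (hm : m + 2 ≤ d) (h : M * (6 + m) ≤ d + 1) (ε : ℝ) :
    μ {ω | ∀ i : Fin M, ¬ ∀ a b,
      dist (X (block h (i, a)) ω (coord hm b)) (cyclicPoints m a b) < ε} =
      farProbability m ε ^ M := by
  let C := (Fin 6 ⊕ Fin m) × (Fin 2 ⊕ Fin m)
  -- Distinct blocks read distinct entries of the Gaussian matrix, so the event becomes a box for a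
  -- product measure and its probability a power.
  let f : Fin M × C → Fin (d + 1) × Fin d := fun p => (block h (p.1, p.2.1), coord hm p.2.2)
  have hf : Function.Injective f := by
    rintro ⟨i, a, b⟩ ⟨i', a', b'⟩ heq
    obtain ⟨h1, h2⟩ := Prod.mk.inj heq
    obtain ⟨rfl, rfl⟩ := Prod.mk.inj ((block h).injective h1)
    obtain rfl : b = b' := coord_injective hm h2
    rfl
  have hZ := hasLaw_pi_precomp (hasLaw_coordinates hlaw hindep) hf
  let S : Set (C → ℝ) := {z | ∀ a b, dist (z (a, b)) (cyclicPoints m a b) < ε}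
  have hS : MeasurableSet S := (isOpen_near m ε).measurableSet
  have hT : MeasurableSet {z : Fin M × C → ℝ | ∀ i, (fun c => z (i, c)) ∈ Sᶜ} := by
    simp only [Set.ofPred_forall]
    refine MeasurableSet.iInter fun i => ?_
    have hmeas : Measurable fun (z : Fin M × C → ℝ) c => z (i, c) := by fun_prop
    exact hmeas hS.compl
  have h1 := hZ.measure_eq hT
  have hpre : (fun (g : Fin M → C → ℝ) (p : Fin M × C) => g p.1 p.2) ⁻¹'
      {z | ∀ i, (fun c => z (i, c)) ∈ Sᶜ} = Set.univ.pi fun _ => Sᶜ := by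
    ext g
    simp [Set.mem_pi]
  rw [← (measurePreserving_uncurry (ι := Fin M) (κ := C) (gaussianReal 0 1)).measure_preimage
    hT.nullMeasurableSet, hpre, Measure.pi_pi, Finset.prod_const, Finset.card_univ,
    Fintype.card_fin] at h1
  exact h1

/-- If a Gaussian simplex is not framed or has no loop, then almost surely all blocks are far from
the cyclic configuration. -/
lemma measure_compl_loop_le (hlaw : ∀ i, HasLaw (X i) (stdGaussian (E d)) μ)
    (hindep : iIndepFun X μ) {m M : ℕ} (hm : m + 2 ≤ d) (h : M * (6 + m) ≤ d + 1) {ε : ℝ}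
    (hε : ∀ Y : Fin 6 ⊕ Fin m → Fin 2 ⊕ Fin m → ℝ,
      (∀ a b, dist (Y a b) (cyclicPoints m a b) < ε) → IsCyclic Y) :
    μ {ω | IsFramed (canonicalFrame d) (convexHull ℝ (Set.range fun i => X i ω)) ∧
      HasCellularLoop (canonicalFrame d) (convexHull ℝ (Set.range fun i => X i ω)) (m + 1)}ᶜ ≤
      farProbability m ε ^ M := by
  rw [← measure_forall_block_far hlaw hindep hm h ε]
  refine measure_mono_ae ?_
  filter_upwards [ae_generalPosition hlaw hindep] with ω hω hnot i hi
  refine hnot ⟨hω.isFramed, hω.hasCellularLoop hm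
    ((Function.Embedding.sectR i (Fin 6 ⊕ Fin m)).trans (block h)) (hε _ fun a b => ?_)⟩
  exact hi a b

end Blocks

end FramedPolytope

end

open FramedPolytope in
theorem tendsto_measure_framed_loop (m : ℕ)
    {Ω : ℕ → Type*} [∀ d, MeasurableSpace (Ω d)]
    (μ : ∀ d, Measure (Ω d)) [∀ d, IsProbabilityMeasure (μ d)]
    (X : ∀ d, Fin (d + 1) → Ω d → EuclideanSpace ℝ (Fin d))
    (hlaw : ∀ d i, HasLaw (X d i) (stdGaussian (EuclideanSpace ℝ (Fin d))) (μ d))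
    (hindep : ∀ d, iIndepFun (X d) (μ d)) :
    Tendsto
      (fun d : ℕ => μ d {ω |
        IsFramed (canonicalFrame d) (convexHull ℝ (Set.range fun i => X d i ω)) ∧
        HasCellularLoop (canonicalFrame d) (convexHull ℝ (Set.range fun i => X d i ω)) (m + 1)})
      atTop (𝓝 1) := by
  obtain ⟨ε, hε, hcyc⟩ := exists_forall_isCyclic m
  have hM : Tendsto (fun d : ℕ => (d + 1) / (6 + m)) atTop atTop :=
    (Nat.tendsto_div_const_atTop (by omega)).comp (tendsto_add_atTop_nat 1)
  have hlim : Tendsto (fun d : ℕ => 1 - farProbability m ε ^ ((d + 1) / (6 + m))) atTop (𝓝 1) := by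
    have := (ENNReal.tendsto_pow_atTop_nhds_zero_of_lt_one (farProbability_lt_one m hε)).comp hM
    simpa using ENNReal.Tendsto.sub tendsto_const_nhds this (Or.inl ENNReal.one_ne_top)
  refine tendsto_of_tendsto_of_tendsto_of_le_of_le' hlim tendsto_const_nhds ?_
    (Eventually.of_forall fun d => prob_le_one)
  filter_upwards [eventually_ge_atTop (m + 2)] with d hd
  have hle := measure_compl_loop_le (hlaw d) (hindep d) hd (Nat.div_mul_le_self (d + 1) (6 + m)) hcyc
  -- Subadditivity is enough here, so measurability of the loop event is not needed.
  refine tsub_le_iff_right.2 (le_trans ?_ (add_le_add le_rfl hle))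
  rw [← measure_univ (μ := μ d), ← Set.union_compl_self]
  exact measure_union_le _ _

theorem mainTheorem4 (k : ℕ) (hk : 1 ≤ k)
    {Ω : ℕ → Type*} [∀ d, MeasurableSpace (Ω d)]
    (μ : ∀ d, Measure (Ω d)) [∀ d, IsProbabilityMeasure (μ d)]
    (X : ∀ d, Fin (d + 1) → Ω d → EuclideanSpace ℝ (Fin d))
    (hlaw : ∀ d i, HasLaw (X d i) (stdGaussian (EuclideanSpace ℝ (Fin d))) (μ d))
    (hindep : ∀ d, iIndepFun (X d) (μ d)) :
    Tendsto
      (fun d : ℕ => μ d {ω |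
        FramedPolytope.IsFramed (FramedPolytope.canonicalFrame d)
          (convexHull ℝ (Set.range fun i => X d i ω)) ∧
        FramedPolytope.HasCellularLoop (FramedPolytope.canonicalFrame d)
          (convexHull ℝ (Set.range fun i => X d i ω)) k})
      atTop (𝓝 1) := by
  obtain ⟨m, rfl⟩ := Nat.exists_eq_add_of_le' hk
  exact tendsto_measure_framed_loop m μ X hlaw hindep
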